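/- Let $\mathbb X,\mathbb Y,\mathbb W$ be finite-dimensional Euclidean spaces and consider the problem $$\text{(P)}\qquad \min_x\ f^0(x):=h(\mathcal A x)+\langle c,x\rangle+p(x)\quad\text{s.t. } \mathcal B x\in b+\mathcal Q,$$ where $\mathcal A:\mathbb X\to\mathbb W$, $\mathcal B:\mathbb X\to\mathbb Y$ are linear, $\mathcal Q\subseteq\mathbb Y$ is a closed convex cone with polar $\mathcal Q^\circ$, $c\in\mathbb X$, $b\in\mathbb Y$, $p:\mathbb X\to(-\infty,+\infty]$ is proper closed convex, and $h:\mathbb W\to(-\infty,+\infty]$ is proper closed convex and essentially smooth with gradient locally Lipschitz on $\operatorname{int}(\operatorname{dom}h)$. Let $\mathrm{SOL}_P$ be the set of optimal solutions of (P). Let $l(x,y)=f^0(x)+\langle y,\mathcal Bx-b\rangle$ if $x\in\operatorname{dom}f^0,\ y\in\mathcal Q^\circ$; $l(x,y)=-\infty$ if $x\in\operatorname{dom}f^0,\ y\notin\mathcal Q^\circ$; $l(x,y)=+\infty$ if $x\notin\operatorname{dom}f^0$. Put $g(y)=\inf_x l(x,y)$, $T_g=-\partial g$ (concave subdifferential)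 and $T_l(x,y)=\{(u,v):(u,-v)\in\partial l(x,y)\}$ (convex-concave subdifferential), with $\mathbb X\times\mathbb Y$ carrying the Euclidean product norm. Distances to the empty set are $+\infty$. Let $0<\sigma_k\uparrow\sigma_\infty\le+\infty$ (nondecreasing), $y^0\in\mathcal Q^\circ$, and let $\{(x^k,y^k)\}$ be an infinite sequence generated by the augmented Lagrangian method: $x^{k+1}$ is an approximate minimizer of $$f_k(x):=f^0(x)+\tfrac1{2\sigma_k}\big(\|\Pi_{\mathcal Q^\circ}[y^k+\sigma_k(\mathcal Bx-b)]\|^2-\|y^k\|^2\big),$$ and $y^{k+1}=\Pi_{\mathcal Q^\circ}[y^k+\sigma_k(\mathcal Bx^{k+1}-b)]$, for all $k\ge 0$, where the following criteria hold for all $k\ge0$: (A$'$) $f_k(x^{k+1})-\inf f_k\le\varepsilon_k^2/(2\sigma_k)$, with $\varepsilon_k\ge0$, $\sum_k\varepsilon_k<\infty$; (B$'$) $f_k(x^{k+1})-\inf f_k\le(\eta_k^2/(2\sigma_k))\|y^{k+1}-y^k\|^2$, with $0\le\eta_k<1$, $\sum_k\eta_k<\infty$; ($\widetilde{\mathrm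 B}$) $\operatorname{dist}(0,\partial f_k(x^{k+1}))\le(\eta_k'/\sigma_k)\|y^{k+1}-y^k\|$, with $0\le\eta_k'\to0$. Suppose that $\{y^k\}$ converges to $y^\infty$ and that $T_g^{-1}$ is calm at the origin for $y^\infty$ with modulus $\kappa_g\ge 0$, i.e. $y^\infty\in T_g^{-1}(0)$ and for some $\varepsilon,\delta>0$, $T_g^{-1}(v)\cap\mathbb B_\delta(y^\infty)\subseteq T_g^{-1}(0)+\kappa_g\|v\|\mathbb B$ whenever $\|v\|\le\varepsilon$ (where $\mathbb B_\delta(y^\infty)$ is the closed ball of radius $\delta$ around $y^\infty$ and $\mathbb B$ the closed unit ball of $\mathbb Y$). Suppose also that $T_l^{-1}$ is upper Lipschitz continuous at the origin with modulus $\kappa_l\ge 0$, i.e. for some $\varepsilon>0$, $\operatorname{dist}(z,T_l^{-1}(0))\le\kappa_l\|w\|$ whenever $\|w\|\le\varepsilon$ and $z\in T_l^{-1}(w)$. Then there exists $\tilde k\ge0$ such that for all $k\ge\tilde k$, $$\operatorname{dist}(x^{k+1},\mathrm{SOL}_P)\le\mu_k'\,\|y^{k+1}-y^k\|,\qquad \mu_k':=\frac{\kappa_l}{\sigma_k}\,(1+\eta_k'^2),$$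 and $\mu_k'\to\mu_\infty':=\kappa_l/\sigma_\infty$ as $k\to\infty$ ($\mu'_\infty=0$ if $\sigma_\infty=+\infty$). -/

import Mathlib

open Filter Topology Set
open scoped Pointwise

noncomputable section

/-! ### Extended-real-valued convex functions -/

section ConvexAnalysis

variable {E : Type*} [NormedAddCommGroup E] [InnerProductSpace ℝ E]

/-- The effective domain of a function with values in `(-∞, +∞]`. -/
def effDom (φ : E → EReal) : Set E := {x | φ x < ⊤}

/-- Proper closed convex functions `φ : E → (-∞, +∞]`: never `-∞`, not identically `+∞`,
lower semicontinuous, with convex epigraph. -/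
structure IsProperClosedConvex (φ : E → EReal) : Prop where
  ne_bot : ∀ x, φ x ≠ ⊥
  exists_ne_top : ∃ x, φ x ≠ ⊤
  lsc : LowerSemicontinuous φ
  convex_epi : Convex ℝ {q : E × ℝ | φ q.1 ≤ (q.2 : EReal)}

/-- Essential smoothness: the interior of the effective domain is nonempty, `φ` is
differentiable there, and the norm of the gradient tends to `+∞` along every sequence of
interior points converging to a boundary point. -/
structure IsEssentiallySmooth [CompleteSpace E] (φ : E → EReal) : Prop where
  nonempty : (interior (effDom φ)).Nonempty
  differentiable : ∀ x ∈ interior (effDom φ), DifferentiableAt ℝ (fun z => (φ z).toReal) x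
  steep : ∀ (u : ℕ → E) (a : E), (∀ n, u n ∈ interior (effDom φ)) →
    a ∈ frontier (interior (effDom φ)) → Tendsto u atTop (𝓝 a) →
    Tendsto (fun n => ‖gradient (fun z => (φ z).toReal) (u n)‖) atTop atTop

/-- The subdifferential of a convex extended-real-valued function (empty where the function is
not finite). -/
def convexSubdiff (φ : E → EReal) (x : E) : Set E :=
  {u | φ x ≠ ⊤ ∧ φ x ≠ ⊥ ∧ ∀ z, φ x + ((inner ℝ u (z - x) : ℝ) : EReal) ≤ φ z}

/-- The subdifferential of a concave extended-real-valued function (empty where the function is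
not finite). -/
def concaveSubdiff (φ : E → EReal) (x : E) : Set E :=
  {u | φ x ≠ ⊤ ∧ φ x ≠ ⊥ ∧ ∀ z, φ z ≤ φ x + ((inner ℝ u (z - x) : ℝ) : EReal)}

end ConvexAnalysis

/-! ### Set-valued mappings -/

section SetValued

variable {U V : Type*}

/-- The inverse of a set-valued mapping. -/
def invMap (Γ : U → Set V) : V → Set U := fun v => {u | v ∈ Γ u}

variable [NormedAddCommGroup U] [NormedAddCommGroup V] [NormedSpace ℝ V]

/-- `Γ` is calm at `ubar` for `vbar` with modulus `κ`. -/
def IsCalmAt (Γ : U → Set V) (ubar : U) (vbar : V) (κ : ℝ) : Prop :=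
  vbar ∈ Γ ubar ∧ ∃ ε > 0, ∃ δ > 0, ∀ u ∈ Metric.closedBall ubar ε,
    Γ u ∩ Metric.closedBall vbar δ ⊆
      Γ ubar + (κ * ‖u - ubar‖) • Metric.closedBall (0 : V) 1

end SetValued

section UpperLipschitz

variable {U V : Type*} [NormedAddCommGroup U] [NormedAddCommGroup V]

/-- `Γ` is (locally) upper Lipschitz continuous at the origin with modulus `κ`. The distance to
the empty set is `+∞`. -/
def IsUpperLipschitzAtZero (Γ : U → Set V) (κ : ℝ) : Prop :=
  ∃ ε > 0, ∀ u ∈ Metric.closedBall (0 : U) ε, ∀ v ∈ Γ u,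
    Metric.infEDist v (Γ 0) ≤ ENNReal.ofReal (κ * ‖u‖)

end UpperLipschitz

/-! ### Polar cones and projections -/

section Polar

variable {Y : Type*} [NormedAddCommGroup Y] [InnerProductSpace ℝ Y]

/-- The polar cone `Q° = {y | ⟪y, d⟫ ≤ 0 for all d ∈ Q}`. -/
def polarCone (Q : ProperCone ℝ Y) : Set Y := {y | ∀ d ∈ Q, inner ℝ y d ≤ 0}

theorem zero_mem_polarCone (Q : ProperCone ℝ Y) : (0 : Y) ∈ polarCone Q :=
  fun d _ => by simp

theorem smul_mem_polarCone {Q : ProperCone ℝ Y} {y : Y} (hy : y ∈ polarCone Q) {t : ℝ}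
    (ht : 0 ≤ t) : t • y ∈ polarCone Q := fun d hd => by
  rw [real_inner_smul_left]
  exact mul_nonpos_of_nonneg_of_nonpos ht (hy d hd)

theorem isClosed_polarCone (Q : ProperCone ℝ Y) : IsClosed (polarCone Q) := by
  have : polarCone Q = ⋂ d ∈ Q, {y : Y | inner ℝ y d ≤ 0} := by
    ext y; simp [polarCone]
  rw [this]
  exact isClosed_biInter fun d _ => isClosed_le (by fun_prop) continuous_const

theorem convex_polarCone (Q : ProperCone ℝ Y) : Convex ℝ (polarCone Q) := by
  intro y hy z hz a b ha hb _ d hd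
  rw [inner_add_left, real_inner_smul_left, real_inner_smul_left]
  nlinarith [hy d hd, hz d hd]

theorem exists_proj_polarCone [CompleteSpace Y] (Q : ProperCone ℝ Y) (z : Y) :
    ∃ y ∈ polarCone Q, ∀ d ∈ polarCone Q, ‖z - y‖ ≤ ‖z - d‖ := by
  obtain ⟨y, hy, h⟩ := exists_norm_eq_iInf_of_complete_convex
    ⟨0, zero_mem_polarCone Q⟩ (isClosed_polarCone Q).isComplete (convex_polarCone Q) z
  refine ⟨y, hy, fun d hd => ?_⟩
  rw [h]
  exact ciInf_le ⟨0, by rintro _ ⟨w, rfl⟩; exact norm_nonneg _⟩ (⟨d, hd⟩ : polarCone Q)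

/-- The Euclidean projection of `z` onto the polar cone of `Q`. -/
def projPolar [CompleteSpace Y] (Q : ProperCone ℝ Y) (z : Y) : Y :=
  (exists_proj_polarCone Q z).choose

theorem projPolar_mem [CompleteSpace Y] (Q : ProperCone ℝ Y) (z : Y) :
    projPolar Q z ∈ polarCone Q :=
  (exists_proj_polarCone Q z).choose_spec.1

theorem norm_sub_projPolar_le [CompleteSpace Y] (Q : ProperCone ℝ Y) (z : Y) {d : Y}
    (hd : d ∈ polarCone Q) : ‖z - projPolar Q z‖ ≤ ‖z - d‖ :=
  (exists_proj_polarCone Q z).choose_spec.2 d hd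

end Polar

/-! ### Convex composite conic programming -/

/-- The data of the problem `min h (A x) + ⟪c, x⟫ + p x` subject to `B x ∈ b + Q`. -/
structure CCCP (X Y W : Type*)
    [NormedAddCommGroup X] [InnerProductSpace ℝ X]
    [NormedAddCommGroup Y] [InnerProductSpace ℝ Y]
    [NormedAddCommGroup W] [InnerProductSpace ℝ W] [CompleteSpace W] where
  A : X →ₗ[ℝ] W
  B : X →ₗ[ℝ] Y
  c : X
  b : Y
  /-- a closed convex cone -/
  Q : ProperCone ℝ Y
  p : X → EReal
  h : W → EReal
  p_convex : IsProperClosedConvex p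
  h_convex : IsProperClosedConvex h
  h_smooth : IsEssentiallySmooth h
  h_lip : LocallyLipschitzOn (interior (effDom h)) (gradient fun w => (h w).toReal)

namespace CCCP

variable {X Y W : Type*}
  [NormedAddCommGroup X] [InnerProductSpace ℝ X]
  [NormedAddCommGroup Y] [InnerProductSpace ℝ Y]
  [NormedAddCommGroup W] [InnerProductSpace ℝ W] [CompleteSpace W]

/-- The objective function `f⁰`. -/
def f0 (P : CCCP X Y W) (x : X) : EReal :=
  P.h (P.A x) + ((inner ℝ P.c x : ℝ) : EReal) + P.p x

/-- The feasible set. -/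
def feasible (P : CCCP X Y W) : Set X := {x | P.B x - P.b ∈ P.Q ∧ P.f0 x < ⊤}

/-- The set of optimal solutions. -/
def solP (P : CCCP X Y W) : Set X :=
  {x | x ∈ P.feasible ∧ ∀ z ∈ P.feasible, P.f0 x ≤ P.f0 z}

open Classical in
/-- The Lagrangian in extended form. -/
def lagrangian (P : CCCP X Y W) (x : X) (y : Y) : EReal :=
  if P.f0 x < ⊤ then
    if y ∈ polarCone P.Q then P.f0 x + ((inner ℝ y (P.B x - P.b) : ℝ) : EReal) else ⊥
  else ⊤

/-- The essential primal objective `f = sup_y l(·, y)`. -/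
def f (P : CCCP X Y W) (x : X) : EReal := ⨆ y, P.lagrangian x y

/-- The essential dual objective `g = inf_x l(x, ·)`. -/
def g (P : CCCP X Y W) (y : Y) : EReal := ⨅ x, P.lagrangian x y

/-- The primal operator `T_f = ∂f`. -/
def Tf (P : CCCP X Y W) (x : X) : Set X := convexSubdiff P.f x

/-- The dual operator `T_g = -∂g`. -/
def Tg (P : CCCP X Y W) (y : Y) : Set Y := - concaveSubdiff P.g y

/-- The KKT operator `T_l (x, y) = {(u, v) | (u, -v) ∈ ∂l(x, y)}` on the Euclidean product
space, where `∂l(x, y)` is the product of the partial subdifferentials of the convex-concave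
function `l`. -/
def Tl (P : CCCP X Y W) (z : WithLp 2 (X × Y)) : Set (WithLp 2 (X × Y)) :=
  {w | w.fst ∈ convexSubdiff (fun x => P.lagrangian x z.snd) z.fst ∧
    -w.snd ∈ concaveSubdiff (fun y => P.lagrangian z.fst y) z.snd}

/-- The augmented Lagrangian function `L_σ(x, y)`. -/
def augLag [CompleteSpace Y] (P : CCCP X Y W) (σ : ℝ) (x : X) (y : Y) : EReal :=
  P.f0 x +
    ((1 / (2 * σ) * (‖projPolar P.Q (y + σ • (P.B x - P.b))‖ ^ 2 - ‖y‖ ^ 2) : ℝ) : EReal)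

/-- Sequences generated by the augmented Lagrangian method with penalty parameters `σ k`, where
the point `x (k + 1)` is an approximate minimizer of `augLag (σ k) · (y k)`; how accurate it is
has to be specified by the stopping criteria below. -/
structure IsALMSequence [CompleteSpace Y] (P : CCCP X Y W) (σ : ℕ → ℝ) (x : ℕ → X)
    (y : ℕ → Y) : Prop where
  init : y 0 ∈ polarCone P.Q
  step : ∀ k, y (k + 1) = projPolar P.Q (y k + σ k • (P.B (x (k + 1)) - P.b))

/-- Criterion (A'): `f_k(x^{k+1}) - inf f_k ≤ ε_k² / (2 σ_k)` with `ε` nonnegative, summable. -/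
structure CriterionA [CompleteSpace Y] (P : CCCP X Y W) (σ ε : ℕ → ℝ) (x : ℕ → X)
    (y : ℕ → Y) : Prop where
  nonneg : ∀ k, 0 ≤ ε k
  summable : Summable ε
  le : ∀ k, P.augLag (σ k) (x (k + 1)) (y k) - ⨅ z, P.augLag (σ k) z (y k) ≤
    ((ε k ^ 2 / (2 * σ k) : ℝ) : EReal)

/-- Criterion (B'): `f_k(x^{k+1}) - inf f_k ≤ (η_k² / (2 σ_k)) ‖y^{k+1} - y^k‖²` with
`0 ≤ η_k < 1` summable. -/
structure CriterionB [CompleteSpace Y] (P : CCCP X Y W) (σ η : ℕ → ℝ) (x : ℕ → X)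
    (y : ℕ → Y) : Prop where
  nonneg : ∀ k, 0 ≤ η k
  lt_one : ∀ k, η k < 1
  summable : Summable η
  le : ∀ k, P.augLag (σ k) (x (k + 1)) (y k) - ⨅ z, P.augLag (σ k) z (y k) ≤
    ((η k ^ 2 / (2 * σ k) * ‖y (k + 1) - y k‖ ^ 2 : ℝ) : EReal)

/-- Criterion (B̃): `dist(0, ∂f_k(x^{k+1})) ≤ (η'_k / σ_k) ‖y^{k+1} - y^k‖` with
`0 ≤ η'_k → 0`. The distance to the empty set is `+∞`. -/
structure CriterionBTilde [CompleteSpace Y] (P : CCCP X Y W) (σ η' : ℕ → ℝ) (x : ℕ → X)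
    (y : ℕ → Y) : Prop where
  nonneg : ∀ k, 0 ≤ η' k
  tendsto : Tendsto η' atTop (𝓝 0)
  le : ∀ k, Metric.infEDist 0 (convexSubdiff (fun z => P.augLag (σ k) z (y k)) (x (k + 1))) ≤
    ENNReal.ofReal (η' k / σ k * ‖y (k + 1) - y k‖)

theorem f0_ne_bot (P : CCCP X Y W) (x : X) : P.f0 x ≠ ⊥ := by
  simp [f0, EReal.add_eq_bot_iff, P.p_convex.ne_bot, P.h_convex.ne_bot]

theorem f_eq_of_mem (P : CCCP X Y W) {x : X} (hx : x ∈ P.feasible) : P.f x = P.f0 x := by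
  apply le_antisymm
  · refine iSup_le fun y => ?_
    unfold lagrangian
    rw [if_pos hx.2]
    split_ifs with hy
    · have h1 : ((inner ℝ y (P.B x - P.b) : ℝ) : EReal) ≤ 0 := by exact_mod_cast hy _ hx.1
      calc _ ≤ P.f0 x + 0 := by gcongr
        _ = _ := add_zero _
    · exact bot_le
  · refine le_trans ?_ (le_iSup _ (0 : Y))
    simp [lagrangian, hx.2, zero_mem_polarCone]

theorem f_eq_top_of_notMem [CompleteSpace Y] (P : CCCP X Y W) {x : X} (hx : x ∉ P.feasible) :
    P.f x = ⊤ := by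
  by_cases hf : P.f0 x < ⊤
  · have hQ : P.B x - P.b ∉ P.Q := fun h => hx ⟨h, hf⟩
    obtain ⟨y, hy, hneg⟩ := ProperCone.hyperplane_separation' P.Q hQ
    have hyp : -y ∈ polarCone P.Q := fun d hd => by
      rw [inner_neg_left, real_inner_comm]
      linarith [hy d hd]
    lift P.f0 x to ℝ using ⟨hf.ne, P.f0_ne_bot x⟩ with r hr
    rw [EReal.eq_top_iff_forall_lt]
    intro s
    set a := inner ℝ (-y) (P.B x - P.b) with ha
    have hapos : 0 < a := by
      rw [ha, inner_neg_left, real_inner_comm]; linarith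
    set t := (|s - r| + 1) / a with ht
    have ht0 : 0 ≤ t := by positivity
    refine lt_of_lt_of_le ?_ (le_iSup _ (t • (-y)))
    have hf' : P.f0 x < ⊤ := by rw [← hr]; exact EReal.coe_lt_top r
    unfold lagrangian
    rw [if_pos hf', if_pos (smul_mem_polarCone hyp ht0), real_inner_smul_left, ← ha, ← hr]
    have : t * a = |s - r| + 1 := by rw [ht]; field_simp
    rw [this]
    norm_cast
    linarith [le_abs_self (s - r)]
  · refine top_le_iff.1 (le_trans ?_ (le_iSup _ (0 : Y)))
    simp [lagrangian, hf]

/-- The optimal solutions are exactly the elements of `T_f⁻¹(0)`. -/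
theorem invMap_Tf_zero [CompleteSpace Y] (P : CCCP X Y W) : invMap P.Tf 0 = P.solP := by
  ext x
  constructor
  · rintro ⟨h1, -, h3⟩
    have hx : x ∈ P.feasible := by
      by_contra hx
      exact h1 (P.f_eq_top_of_notMem hx)
    refine ⟨hx, fun z hz => ?_⟩
    have := h3 z
    rwa [P.f_eq_of_mem hx, P.f_eq_of_mem hz, inner_zero_left, EReal.coe_zero, add_zero] at this
  · rintro ⟨hx, h⟩
    refine ⟨?_, ?_, fun z => ?_⟩
    · rw [P.f_eq_of_mem hx]; exact hx.2.ne
    · rw [P.f_eq_of_mem hx]; exact P.f0_ne_bot x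
    · rw [P.f_eq_of_mem hx, inner_zero_left, EReal.coe_zero, add_zero]
      by_cases hz : z ∈ P.feasible
      · rw [P.f_eq_of_mem hz]; exact h z hz
      · rw [P.f_eq_top_of_notMem hz]; exact le_top

end CCCP

end

/-! ### Projection onto the polar cone. -/

section Projection

variable {Y : Type*} [NormedAddCommGroup Y] [InnerProductSpace ℝ Y] [CompleteSpace Y]

/-! An inexact step of the method solves a perturbed KKT system, and its residual is of the order of
the multiplier step. If `u ∈ ∂f_k(x^{k+1})`, then `(x^{k+1}, y^{k+1}) ∈ T_l⁻¹(u, -(y^{k+1} -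
y^k)/σ_k)` (`mem_invMap_Tl_of_mem_subdiff_augLag`). The primal half holds because `½‖Π z‖²` has
gradient `Π z`, so `f_k` and `l(·, y^{k+1})` agree to first order at `x^{k+1}`; the dual half is the
variational inequality of the projection.

Criterion (B̃) makes the residual at most `√(1 + η'²) ‖y^{k+1} - y^k‖/σ_k`, up to an arbitrarily
small error. It tends to zero since `y` converges and `σ` is bounded away from zero, so the upper
Lipschitz property eventually applies. The resulting distance to `T_l⁻¹(0)` bounds the distance to
the solution set, since zeros of `T_l` are saddle points (`fst_mem_solP`). The factor `1 + η'²` is a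
weakening of `√(1 + η'²)`. -/

theorem inner_sub_projPolar_le_zero (Q : ProperCone ℝ Y) (z : Y) {d : Y} (hd : d ∈ polarCone Q) :
    inner ℝ (z - projPolar Q z) (d - projPolar Q z) ≤ 0 := by
  refine (norm_eq_iInf_iff_real_inner_le_zero (convex_polarCone Q) (projPolar_mem Q z)).1 ?_ d hd
  have : Nonempty (polarCone Q) := ⟨⟨0, zero_mem_polarCone Q⟩⟩
  refine le_antisymm (le_ciInf fun w => norm_sub_projPolar_le Q z w.2) ?_
  exact ciInf_le ⟨0, by rintro _ ⟨w, rfl⟩; exact norm_nonneg _⟩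
    (⟨_, projPolar_mem Q z⟩ : polarCone Q)

/-- The variational inequality, tested at `0` and at twice the projection, gives both signs. -/
theorem inner_sub_projPolar_self (Q : ProperCone ℝ Y) (z : Y) :
    inner ℝ (z - projPolar Q z) (projPolar Q z) = 0 := by
  have h0 := inner_sub_projPolar_le_zero Q z (zero_mem_polarCone Q)
  have h2 := inner_sub_projPolar_le_zero Q z
    (smul_mem_polarCone (projPolar_mem Q z) (zero_le_two (α := ℝ)))
  rw [two_smul, add_sub_cancel_right] at h2
  rw [zero_sub, inner_neg_right] at h0
  linarith

/-- The quadratic upper bound for `½ ‖Π z‖²`, whose gradient is `Π`. -/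
theorem norm_sq_projPolar_add_le (Q : ProperCone ℝ Y) (z d : Y) :
    ‖projPolar Q (z + d)‖ ^ 2 ≤
      ‖projPolar Q z‖ ^ 2 + 2 * inner ℝ (projPolar Q z) d + ‖d‖ ^ 2 := by
  set q := projPolar Q z with hq
  set r := projPolar Q (z + d) with hr
  have h1 : inner ℝ (z + d - r) r = 0 := inner_sub_projPolar_self Q (z + d)
  have h2 : inner ℝ (z - q) (r - q) ≤ 0 :=
    inner_sub_projPolar_le_zero Q z (projPolar_mem Q (z + d))
  have h3 : inner ℝ (z - q) q = 0 := inner_sub_projPolar_self Q z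
  -- The right-hand side of the goal is `‖q + d‖²`. Here `h1`, `h2`, `h3` yield `‖r‖² ≤ ⟪q + d, r⟫`,
  -- and `h4` bounds the inner product by the mean of the two squares.
  have h4 : 0 ≤ ‖q + d - r‖ ^ 2 := sq_nonneg _
  rw [norm_sub_sq_real, norm_add_sq_real] at h4
  simp only [inner_sub_left, inner_add_left, inner_sub_right, real_inner_self_eq_norm_sq]
    at h1 h2 h3 h4
  linarith

end Projection

/-! ### Convexity of the objective and saddle points of the Lagrangian. -/

namespace IsProperClosedConvex

variable {E : Type*} [NormedAddCommGroup E] [InnerProductSpace ℝ E]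

theorem toReal_combo_le {φ : E → EReal} (hφ : IsProperClosedConvex φ) {x z : E}
    (hx : φ x ≠ ⊤) (hz : φ z ≠ ⊤) {s t : ℝ} (hs : 0 ≤ s) (ht : 0 ≤ t) (hst : s + t = 1) :
    φ (s • x + t • z) ≤ ((s * (φ x).toReal + t * (φ z).toReal : ℝ) : EReal) :=
  hφ.convex_epi (x := (x, (φ x).toReal)) (y := (z, (φ z).toReal))
    (EReal.coe_toReal hx (hφ.ne_bot x)).ge (EReal.coe_toReal hz (hφ.ne_bot z)).ge hs ht hst

end IsProperClosedConvex

namespace CCCP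

variable {X Y W : Type*}
  [NormedAddCommGroup X] [InnerProductSpace ℝ X]
  [NormedAddCommGroup Y] [InnerProductSpace ℝ Y]
  [NormedAddCommGroup W] [InnerProductSpace ℝ W] [CompleteSpace W]

theorem h_ne_top (P : CCCP X Y W) {x : X} (hx : P.f0 x ≠ ⊤) : P.h (P.A x) ≠ ⊤ := fun h =>
  hx <| by
    rw [f0, h, EReal.top_add_coe, EReal.top_add_of_ne_bot (P.p_convex.ne_bot x)]

theorem p_ne_top (P : CCCP X Y W) {x : X} (hx : P.f0 x ≠ ⊤) : P.p x ≠ ⊤ := fun h =>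
  hx <| by
    rw [f0, h, EReal.add_top_of_ne_bot]
    simp [EReal.add_eq_bot_iff, P.h_convex.ne_bot]

theorem toReal_f0 (P : CCCP X Y W) {x : X} (hx : P.f0 x ≠ ⊤) :
    (P.f0 x).toReal = (P.h (P.A x)).toReal + inner ℝ P.c x + (P.p x).toReal := by
  have h1 := EReal.coe_toReal (P.h_ne_top hx) (P.h_convex.ne_bot _)
  have h2 := EReal.coe_toReal (P.p_ne_top hx) (P.p_convex.ne_bot _)
  rw [f0, ← h1, ← h2]
  norm_cast

theorem f0_combo_le (P : CCCP X Y W) {x z : X} (hx : P.f0 x ≠ ⊤) (hz : P.f0 z ≠ ⊤) {s t : ℝ}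
    (hs : 0 ≤ s) (ht : 0 ≤ t) (hst : s + t = 1) :
    P.f0 (s • x + t • z) ≤ ((s * (P.f0 x).toReal + t * (P.f0 z).toReal : ℝ) : EReal) := by
  have h1 := P.h_convex.toReal_combo_le (P.h_ne_top hx) (P.h_ne_top hz) hs ht hst
  have h2 := P.p_convex.toReal_combo_le (P.p_ne_top hx) (P.p_ne_top hz) hs ht hst
  rw [P.toReal_f0 hx, P.toReal_f0 hz, f0, map_add, map_smul, map_smul]
  refine (add_le_add (add_le_add h1 le_rfl) h2).trans (le_of_eq ?_)
  rw [inner_add_right, real_inner_smul_right, real_inner_smul_right]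
  norm_cast
  ring

theorem lagrangian_of_mem (P : CCCP X Y W) {x : X} {y : Y} (hx : P.f0 x ≠ ⊤)
    (hy : y ∈ polarCone P.Q) :
    P.lagrangian x y = (((P.f0 x).toReal + inner ℝ y (P.B x - P.b) : ℝ) : EReal) := by
  rw [lagrangian, if_pos hx.lt_top, if_pos hy, EReal.coe_add, EReal.coe_toReal hx (P.f0_ne_bot x)]

theorem lagrangian_of_eq_top (P : CCCP X Y W) {x : X} (hx : P.f0 x = ⊤) (y : Y) :
    P.lagrangian x y = ⊤ := by
  simp [lagrangian, hx]

/-- A zero of `T_l` is a saddle point: `f x = l(x, y) ≤ l(x', y) ≤ f x'`. Finiteness of `l(x, y)`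
forces feasibility, and `f` agrees with `f⁰` on feasible points. -/
theorem fst_mem_solP [CompleteSpace Y] (P : CCCP X Y W) {z : WithLp 2 (X × Y)}
    (hz : z ∈ invMap P.Tl 0) : z.fst ∈ P.solP := by
  obtain ⟨⟨h1, -, h3⟩, -, -, h6⟩ := hz
  have hf : P.f z.fst = P.lagrangian z.fst z.snd :=
    le_antisymm (iSup_le fun y => by simpa using h6 y) (le_iSup _ z.snd)
  have hx : z.fst ∈ P.feasible := by
    by_contra hx
    exact h1 (hf.symm.trans (P.f_eq_top_of_notMem hx))
  refine ⟨hx, fun x hx' => ?_⟩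
  rw [← P.f_eq_of_mem hx, ← P.f_eq_of_mem hx', hf]
  exact le_trans (by simpa using h3 x) (le_iSup _ z.snd)

/-! ### From subgradients of the augmented Lagrangian to the KKT operator. -/

variable [CompleteSpace Y]

theorem f0_ne_top_of_mem_subdiff_augLag (P : CCCP X Y W) {σ : ℝ} {x u : X} {y : Y}
    (hu : u ∈ convexSubdiff (fun z => P.augLag σ z y) x) : P.f0 x ≠ ⊤ := fun h =>
  hu.1 <| by simp only [augLag, h, EReal.top_add_coe]

/-- Convexity of `f⁰` plus the quadratic upper bound for the penalty term. The error is of order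
`t²`, so it vanishes after division by `t`; this replaces a subdifferential sum rule. -/
theorem augLag_combo_le (P : CCCP X Y W) {σ : ℝ} (hσ : 0 < σ) {x z : X} (y : Y)
    (hx : P.f0 x ≠ ⊤) (hz : P.f0 z ≠ ⊤) {t : ℝ} (ht : 0 ≤ t) (ht1 : t ≤ 1) :
    P.augLag σ ((1 - t) • x + t • z) y ≤
      (((1 - t) * (P.f0 x).toReal + t * (P.f0 z).toReal +
        (1 / (2 * σ) * (‖projPolar P.Q (y + σ • (P.B x - P.b))‖ ^ 2 - ‖y‖ ^ 2) +
          t * inner ℝ (projPolar P.Q (y + σ • (P.B x - P.b))) (P.B (z - x)) +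
          t ^ 2 * (σ / 2 * ‖P.B (z - x)‖ ^ 2)) : ℝ) : EReal) := by
  rw [EReal.coe_add]
  refine add_le_add (P.f0_combo_le hx hz (by linarith) ht (by ring)) (EReal.coe_le_coe_iff.2 ?_)
  have harg : y + σ • (P.B ((1 - t) • x + t • z) - P.b) =
      (y + σ • (P.B x - P.b)) + (σ * t) • P.B (z - x) := by
    simp only [map_add, map_smul, map_sub]
    module
  have h := norm_sq_projPolar_add_le P.Q (y + σ • (P.B x - P.b)) ((σ * t) • P.B (z - x))
  rw [harg]
  rw [real_inner_smul_right, norm_smul, mul_pow, Real.norm_eq_abs, sq_abs] at h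
  set q := projPolar P.Q (y + σ • (P.B x - P.b))
  calc _ ≤ 1 / (2 * σ) * (‖q‖ ^ 2 + 2 * (σ * t * inner ℝ q (P.B (z - x))) +
        (σ * t) ^ 2 * ‖P.B (z - x)‖ ^ 2 - ‖y‖ ^ 2) := by gcongr
    _ = _ := by field_simp; ring

/-- Subgradients of the augmented Lagrangian are subgradients of the Lagrangian at the updated
multiplier. -/
theorem mem_subdiff_lagrangian_of_mem_subdiff_augLag (P : CCCP X Y W) {σ : ℝ} (hσ : 0 < σ)
    {x u : X} {y : Y} (hu : u ∈ convexSubdiff (fun z => P.augLag σ z y) x) :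
    u ∈ convexSubdiff
      (fun z => P.lagrangian z (projPolar P.Q (y + σ • (P.B x - P.b)))) x := by
  have hx := P.f0_ne_top_of_mem_subdiff_augLag hu
  set q := projPolar P.Q (y + σ • (P.B x - P.b)) with hq
  have hqm : q ∈ polarCone P.Q := projPolar_mem _ _
  refine ⟨?_, ?_, fun z => ?_⟩
  · simp only [P.lagrangian_of_mem hx hqm]; exact EReal.coe_ne_top _
  · simp only [P.lagrangian_of_mem hx hqm]; exact EReal.coe_ne_bot _
  by_cases hz : P.f0 z = ⊤
  · simp only [P.lagrangian_of_eq_top hz]; exact le_top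
  simp only [P.lagrangian_of_mem hx hqm, P.lagrangian_of_mem hz hqm]
  norm_cast
  -- The subgradient inequality at a point of the segment from `x` to `z`, divided by `t`; letting
  -- `t` tend to `0` then removes the quadratic term.
  have key : ∀ t ∈ Set.Ioc (0 : ℝ) 1, inner ℝ u (z - x) ≤
      (P.f0 z).toReal - (P.f0 x).toReal + inner ℝ q (P.B (z - x)) +
        t * (σ / 2 * ‖P.B (z - x)‖ ^ 2) := fun t ht => by
    have h1 := (hu.2.2 ((1 - t) • x + t • z)).trans (P.augLag_combo_le hσ y hx hz ht.1.le ht.2)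
    have h2 : (1 - t) • x + t • z - x = t • (z - x) := by module
    simp only [h2, augLag, real_inner_smul_right, ← hq] at h1
    rw [← EReal.coe_toReal hx (P.f0_ne_bot x)] at h1
    norm_cast at h1
    refine le_of_mul_le_mul_left ?_ ht.1
    simp only [EReal.toReal_coe] at h1
    linarith
  have hlim : Tendsto (fun t : ℝ => (P.f0 z).toReal - (P.f0 x).toReal + inner ℝ q (P.B (z - x)) +
      t * (σ / 2 * ‖P.B (z - x)‖ ^ 2)) (𝓝[>] 0)
      (𝓝 ((P.f0 z).toReal - (P.f0 x).toReal + inner ℝ q (P.B (z - x)) +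
        0 * (σ / 2 * ‖P.B (z - x)‖ ^ 2))) :=
    (Continuous.tendsto (by fun_prop) 0).mono_left nhdsWithin_le_nhds
  have := ge_of_tendsto hlim
    (by filter_upwards [Ioc_mem_nhdsGT (zero_lt_one (α := ℝ))] with t ht using key t ht)
  simp only [map_sub, inner_sub_right] at this ⊢
  linarith

theorem mem_invMap_Tl_of_mem_subdiff_augLag (P : CCCP X Y W) {σ : ℝ} (hσ : 0 < σ)
    {x u : X} {y y' : Y} (hy' : y' = projPolar P.Q (y + σ • (P.B x - P.b)))
    (hu : u ∈ convexSubdiff (fun z => P.augLag σ z y) x) :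
    WithLp.toLp 2 (x, y') ∈ invMap P.Tl (WithLp.toLp 2 (u, -(σ⁻¹ • (y' - y)))) := by
  have hx := P.f0_ne_top_of_mem_subdiff_augLag hu
  have hqm : y' ∈ polarCone P.Q := hy' ▸ projPolar_mem _ _
  refine ⟨?_, ?_⟩
  · simpa [hy'] using P.mem_subdiff_lagrangian_of_mem_subdiff_augLag hσ hu
  change - -(σ⁻¹ • (y' - y)) ∈ concaveSubdiff (fun y => P.lagrangian x y) y'
  rw [neg_neg]
  refine ⟨?_, ?_, fun d => ?_⟩
  · simp only [P.lagrangian_of_mem hx hqm]; exact EReal.coe_ne_top _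
  · simp only [P.lagrangian_of_mem hx hqm]; exact EReal.coe_ne_bot _
  by_cases hd : d ∈ polarCone P.Q
  · simp only [P.lagrangian_of_mem hx hqm, P.lagrangian_of_mem hx hd]
    norm_cast
    have h := inner_sub_projPolar_le_zero P.Q (y + σ • (P.B x - P.b)) hd
    rw [← hy'] at h
    -- Up to the factor `σ`, the projection residual is the gap between the linear slope `B x - b`
    -- of `l(x, ·)` and the claimed supergradient.
    have h1 : y + σ • (P.B x - P.b) - y' = σ • ((P.B x - P.b) - σ⁻¹ • (y' - y)) := by
      rw [smul_sub σ (_ - _), smul_inv_smul₀ hσ.ne']; abel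
    rw [h1, real_inner_smul_left] at h
    have h2 := nonpos_of_mul_nonpos_right h hσ
    rw [inner_sub_left, real_inner_comm, inner_sub_left] at h2
    linarith
  · have : P.lagrangian x d = ⊥ := by simp [lagrangian, hx.lt_top, hd]
    simp only [this, bot_le]

/-- The coordinate projection is nonexpansive for the product norm and maps `T_l⁻¹(0)` into the
solution set. -/
theorem infEDist_solP_le_of_mem_invMap_Tl (P : CCCP X Y W) (z : WithLp 2 (X × Y)) :
    Metric.infEDist z.fst P.solP ≤ Metric.infEDist z (invMap P.Tl 0) := by
  refine Metric.le_infEDist.2 fun v hv => ?_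
  refine (Metric.infEDist_le_edist_of_mem (P.fst_mem_solP hv)).trans ?_
  rw [edist_dist, edist_dist]
  refine ENNReal.ofReal_le_ofReal ?_
  rw [WithLp.prod_dist_eq_of_L2]
  exact Real.le_sqrt_of_sq_le (by nlinarith [sq_nonneg (dist z.snd v.snd)])

end CCCP

/-! ### The limit of the modulus and the error bound. -/

theorem tendsto_div_mul_one_add_sq {σ η : ℕ → ℝ} {σinf : EReal} (hσ_pos : ∀ k, 0 < σ k)
    (hσ_mono : Monotone σ) (hσ_lim : Tendsto (fun k => (σ k : EReal)) atTop (𝓝 σinf))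
    (hη : Tendsto η atTop (𝓝 0)) (κ : ℝ) :
    Tendsto (fun k => κ / σ k * (1 + η k ^ 2)) atTop
      (𝓝 (if σinf = ⊤ then 0 else κ / σinf.toReal)) := by
  have hη' : Tendsto (fun k => 1 + η k ^ 2) atTop (𝓝 1) := by
    simpa using (hη.pow 2).const_add 1
  suffices h : Tendsto (fun k => κ / σ k) atTop (𝓝 (if σinf = ⊤ then 0 else κ / σinf.toReal)) by
    simpa using h.mul hη'
  have h0 : (σ 0 : EReal) ≤ σinf :=
    ge_of_tendsto' hσ_lim fun k => EReal.coe_le_coe_iff.2 (hσ_mono (Nat.zero_le k))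
  split_ifs with hinf
  · rw [hinf, EReal.tendsto_coe_nhds_top_iff] at hσ_lim
    exact hσ_lim.const_div_atTop κ
  · have hbot : σinf ≠ ⊥ := ((EReal.bot_lt_coe _).trans_le h0).ne'
    lift σinf to ℝ using ⟨hinf, hbot⟩
    rw [EReal.toReal_coe]
    have hpos : 0 < σinf := (hσ_pos 0).trans_le (EReal.coe_le_coe_iff.1 h0)
    exact tendsto_const_nhds.div (EReal.tendsto_coe.1 hσ_lim) hpos.ne'

theorem proposition3
    {X Y W : Type*}
    [NormedAddCommGroup X] [InnerProductSpace ℝ X] [FiniteDimensional ℝ X]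
    [NormedAddCommGroup Y] [InnerProductSpace ℝ Y] [FiniteDimensional ℝ Y] [CompleteSpace Y]
    [NormedAddCommGroup W] [InnerProductSpace ℝ W] [FiniteDimensional ℝ W] [CompleteSpace W]
    (P : CCCP X Y W)
    (σ : ℕ → ℝ) (σinf : EReal)
    (hσ_pos : ∀ k, 0 < σ k) (hσ_mono : Monotone σ)
    (hσ_lim : Tendsto (fun k => (σ k : EReal)) atTop (𝓝 σinf))
    (ε η η' : ℕ → ℝ) (x : ℕ → X) (y : ℕ → Y) (yinf : Y)
    (hALM : P.IsALMSequence σ x y)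
    (hA : P.CriterionA σ ε x y)
    (hy : Tendsto y atTop (𝓝 yinf))
    (hB : P.CriterionB σ η x y)
    (κg : ℝ) (hκg : 0 ≤ κg)
    (hcalm : IsCalmAt (invMap P.Tg) 0 yinf κg)
    (hBt : P.CriterionBTilde σ η' x y)
    (κl : ℝ) (hκl : 0 ≤ κl)
    (hlip : IsUpperLipschitzAtZero (invMap P.Tl) κl) :
    (∃ k₀ : ℕ, ∀ k ≥ k₀,
      Metric.infEDist (x (k + 1)) P.solP ≤
        ENNReal.ofReal (κl / σ k * (1 + η' k ^ 2) * ‖y (k + 1) - y k‖)) ∧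
    Tendsto (fun k => κl / σ k * (1 + η' k ^ 2)) atTop
      (𝓝 (if σinf = ⊤ then 0 else κl / σinf.toReal)) := by
  refine ⟨?_, tendsto_div_mul_one_add_sq hσ_pos hσ_mono hσ_lim hBt.tendsto κl⟩
  obtain ⟨r, hr, hlip⟩ := hlip
  -- the size of the residual before the approximation of the infimum distance
  set ρ : ℕ → ℝ := fun k => (1 + η' k ^ 2) * ((σ k)⁻¹ * ‖y (k + 1) - y k‖) with hρ
  have hρ_lim : Tendsto ρ atTop (𝓝 0) := by
    have h1 : Tendsto (fun k => 1 + η' k ^ 2) atTop (𝓝 1) := by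
      simpa using (hBt.tendsto.pow 2).const_add 1
    have h2 : Tendsto (fun k => ‖y (k + 1) - y k‖) atTop (𝓝 0) := by
      simpa using ((hy.comp (tendsto_add_atTop_nat 1)).sub hy).norm
    have h3 : Tendsto (fun k => (σ k)⁻¹ * ‖y (k + 1) - y k‖) atTop (𝓝 0) := by
      refine squeeze_zero (fun k => mul_nonneg (inv_nonneg.2 (hσ_pos k).le) (norm_nonneg _))
        (fun k => ?_) (by simpa using h2.const_mul (σ 0)⁻¹)
      gcongr
      · exact hσ_pos 0
      · exact hσ_mono (Nat.zero_le k)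
    simpa using h1.mul h3
  obtain ⟨k₀, hk₀⟩ := eventually_atTop.1 (hρ_lim.eventually_lt_const hr)
  refine ⟨k₀, fun k hk => ?_⟩
  set s := (σ k)⁻¹ * ‖y (k + 1) - y k‖ with hs
  have hs0 : 0 ≤ s := mul_nonneg (inv_nonneg.2 (hσ_pos k).le) (norm_nonneg _)
  have hη0 := hBt.nonneg k
  have hbound : κl / σ k * (1 + η' k ^ 2) * ‖y (k + 1) - y k‖ = κl * ρ k := by
    simp only [hρ]; ring
  rw [hbound]
  -- The slack `δ` yields an actual subgradient from the infimum distance without asking that it be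
  -- attained; `ρ k < r` leaves room for it.
  have key : ∀ δ > 0, ρ k + δ ≤ r →
      Metric.infEDist (x (k + 1)) P.solP ≤ ENNReal.ofReal (κl * (ρ k + δ)) := fun δ hδ hδr => by
    have hlt : Metric.infEDist 0
        (convexSubdiff (fun z => P.augLag (σ k) z (y k)) (x (k + 1))) <
        ENNReal.ofReal (η' k * s + δ) := by
      refine (hBt.le k).trans_lt ?_
      rw [ENNReal.ofReal_lt_ofReal_iff (by positivity)]
      have : η' k / σ k * ‖y (k + 1) - y k‖ = η' k * s := by rw [hs]; ring
      linarith
    obtain ⟨u, hu, hud⟩ := Metric.infEDist_lt_iff.1 hlt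
    rw [edist_dist, ENNReal.ofReal_lt_ofReal_iff (by positivity), dist_zero_left] at hud
    have hmem := P.mem_invMap_Tl_of_mem_subdiff_augLag (hσ_pos k) (hALM.step k) hu
    have hsnd : ‖-((σ k)⁻¹ • (y (k + 1) - y k))‖ = s := by
      rw [norm_neg, norm_smul, Real.norm_of_nonneg (inv_nonneg.2 (hσ_pos k).le)]
    have hnorm : ‖WithLp.toLp 2 (u, -((σ k)⁻¹ • (y (k + 1) - y k)))‖ ≤ ρ k + δ := by
      rw [WithLp.prod_norm_eq_of_L2]
      change √(‖u‖ ^ 2 + ‖-((σ k)⁻¹ • (y (k + 1) - y k))‖ ^ 2) ≤ _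
      rw [hsnd]
      -- The left side is `(1 + η'²) s²` and the right side `(1 + η'²)² s²`.
      have h2 : (η' k * s) ^ 2 + s ^ 2 ≤ ρ k ^ 2 := by
        have : ρ k = (1 + η' k ^ 2) * s := rfl
        rw [this]
        nlinarith [mul_nonneg (sq_nonneg s) (sq_nonneg (η' k)),
          mul_nonneg (mul_nonneg (sq_nonneg s) (sq_nonneg (η' k))) (sq_nonneg (η' k))]
      have hρ0 : 0 ≤ ρ k := mul_nonneg (by positivity) hs0
      have h3 : η' k * s ≤ ρ k :=
        le_of_abs_le <| abs_le_of_sq_le_sq ((le_add_of_nonneg_right (sq_nonneg s)).trans h2) hρ0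
      refine Real.sqrt_le_iff.2 ⟨by positivity, ?_⟩
      have h4 : ‖u‖ ^ 2 ≤ (η' k * s + δ) ^ 2 := by gcongr
      -- Expanding both squares, the cross term `2 η' s δ` is absorbed by `2 ρ δ` thanks to `h3`.
      nlinarith
    refine (P.infEDist_solP_le_of_mem_invMap_Tl _).trans ((hlip _ ?_ _ hmem).trans ?_)
    · simpa using hnorm.trans hδr
    · gcongr
  have hlim : Tendsto (fun δ : ℝ => ENNReal.ofReal (κl * (ρ k + δ))) (𝓝[>] 0)
      (𝓝 (ENNReal.ofReal (κl * (ρ k + 0)))) :=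
    ((ENNReal.continuous_ofReal.comp (by fun_prop)).tendsto 0).mono_left nhdsWithin_le_nhds
  rw [add_zero] at hlim
  refine ge_of_tendsto hlim ?_
  filter_upwards [Ioc_mem_nhdsGT (sub_pos.2 (hk₀ k hk))] with δ hδ
  exact key δ hδ.1 (by linarith [hδ.2])
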